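/- Theorem (Inductive Property). Let $D\ge 0$ and $K\ge 1$ be integers, and let $$p(x)=\sum_{k=1}^K \pi_k\,(2\pi)^{-D/2}\,|\Sigma_k|^{-1/2}\,e^{-\frac12 (x-\mu_k)^T\Sigma_k^{-1}(x-\mu_k)},\qquad x\in\mathbb{R}^D,$$ be the density of a mixture of Gaussians, with weights $\pi_k>0$, $\sum_k\pi_k=1$, means $\mu_k\in\mathbb{R}^D$ and symmetric positive definite covariance matrices $\Sigma_k\in\mathbb{R}^{D\times D}$. Put $f=-\ln p$. An equilibrium vector is a point $x$ with $\nabla f(x)=0$; it is hyperbolic if the Hessian of $f$ at $x$ has no zero eigenvalue, and a stable equilibrium vector (SEV) if it is hyperbolic and all eigenvalues of this Hessian are positive. Assume that $f$ is a Morse function, i.e. that all its equilibrium vectors are hyperbolic. Let $R$ be a continuously differentiable Riemannian metric on $\mathbb{R}^D$, i.e. a $C^1$ map that assigns to each $x\in\mathbb{R}^D$ a symmetric positive definite matrix $R(x)\in\mathbb{R}^{D\times D}$, and assume that its condition number is bounded: $\sup_{x\in\mathbb{R}^D}\|R(x)\|\,\|R(x)^{-1}\|<\infty$ in the operator norm of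 the Euclidean norm. Consider the MoG gradient system $$\frac{dx}{dt}=R(x)^{-1}\,\nabla\ln p(x)=-R(x)^{-1}\nabla f(x).$$ A trajectory is a solution $x:[0,\infty)\to\mathbb{R}^D$ of it, and the basin cell of an SEV $x^0$ is the closed set $$\mathfrak{B}(x^0)=\mathrm{cl}\{x(0) : x(\cdot)\text{ is a trajectory with }\lim_{t\to\infty}x(t)=x^0\}.$$ Then there is exactly one trajectory from each initial point in $\mathbb{R}^D$; every trajectory is bounded on $[0,\infty)$ and converges, as $t\to\infty$, to an equilibrium vector. Moreover the system has only finitely many SEVs $x^0_1,\dots,x^0_s$, and $$\mathbb{R}^D=\mathfrak{B}(x^0_1)\cup\dots\cup\mathfrak{B}(x^0_s),$$ where $\mathfrak{B}(x^0_i)\cap\mathfrak{B}(x^0_j)$ has Lebesgue measure zero whenever $i\ne j$. -/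

import Mathlib

open Set Filter Topology MeasureTheory

noncomputable section

/-- The parameters of a mixture of `K` Gaussians on `ℝ^D`: positive weights that sum to one,
means, and symmetric positive definite covariance matrices. -/
structure GaussianMixture (D K : ℕ) where
  weight : Fin K → ℝ
  mean : Fin K → EuclideanSpace ℝ (Fin D)
  cov : Fin K → Matrix (Fin D) (Fin D) ℝ
  weight_pos : ∀ k, 0 < weight k
  weight_sum : ∑ k, weight k = 1
  cov_posDef : ∀ k, (cov k).PosDef

/-- The density of the normal distribution with mean `μ` and covariance matrix `S`:
`(2π)^(-D/2) |S|^(-1/2) exp (-(x - μ)ᵀ S⁻¹ (x - μ) / 2)`. -/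
def gaussianDensity {D : ℕ} (μ : EuclideanSpace ℝ (Fin D)) (S : Matrix (Fin D) (Fin D) ℝ)
    (x : EuclideanSpace ℝ (Fin D)) : ℝ :=
  (2 * Real.pi) ^ (-(D : ℝ) / 2) * S.det ^ (-(1 : ℝ) / 2) *
    Real.exp (-(1 / 2) * inner ℝ (x - μ) (Matrix.toEuclideanCLM (𝕜 := ℝ) S⁻¹ (x - μ)))

/-- The density `p` of the mixture. -/
def GaussianMixture.density {D K : ℕ} (M : GaussianMixture D K)
    (x : EuclideanSpace ℝ (Fin D)) : ℝ :=
  ∑ k, M.weight k * gaussianDensity (M.mean k) (M.cov k) x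

/-- The height function `f = - ln p` of the mixture. -/
def GaussianMixture.potential {D K : ℕ} (M : GaussianMixture D K)
    (x : EuclideanSpace ℝ (Fin D)) : ℝ :=
  -Real.log (M.density x)

/-- The vector field `x ↦ -R(x)⁻¹ ∇f(x)` of the generalized gradient system of `f` with respect to
the metric `R`. -/
def gradField {D : ℕ} (f : EuclideanSpace ℝ (Fin D) → ℝ)
    (R : EuclideanSpace ℝ (Fin D) → Matrix (Fin D) (Fin D) ℝ) (x : EuclideanSpace ℝ (Fin D)) :
    EuclideanSpace ℝ (Fin D) :=
  -Matrix.toEuclideanCLM (𝕜 := ℝ) (R x)⁻¹ (gradient f x)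

/-- A trajectory, in forward time, of the generalized gradient system of `f` with respect to `R`:
a solution of `dx/dt = -R(x)⁻¹ ∇f(x)` on `[0, ∞)` (only the values at times `t ≥ 0` matter). -/
def IsTrajectory {D : ℕ} (f : EuclideanSpace ℝ (Fin D) → ℝ)
    (R : EuclideanSpace ℝ (Fin D) → Matrix (Fin D) (Fin D) ℝ)
    (γ : ℝ → EuclideanSpace ℝ (Fin D)) : Prop :=
  IsIntegralCurveOn γ (fun _ x => gradField f R x) (Ici 0)

/-- An equilibrium vector, or critical point, of `f`. -/
def IsEquilibrium {D : ℕ} (f : EuclideanSpace ℝ (Fin D) → ℝ) (x : EuclideanSpace ℝ (Fin D)) :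
    Prop :=
  gradient f x = 0

/-- The Hessian of `f` at `x`, as a linear operator: the derivative of the gradient. -/
def hessianOp {D : ℕ} (f : EuclideanSpace ℝ (Fin D) → ℝ) (x : EuclideanSpace ℝ (Fin D)) :
    Module.End ℝ (EuclideanSpace ℝ (Fin D)) :=
  (fderiv ℝ (gradient f) x : EuclideanSpace ℝ (Fin D) →ₗ[ℝ] EuclideanSpace ℝ (Fin D))

/-- A hyperbolic equilibrium vector: the Hessian has no zero eigenvalue. -/
def IsHyperbolicEquilibrium {D : ℕ} (f : EuclideanSpace ℝ (Fin D) → ℝ)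
    (x : EuclideanSpace ℝ (Fin D)) : Prop :=
  IsEquilibrium f x ∧ ¬ (hessianOp f x).HasEigenvalue 0

/-- A smooth function is a Morse function if all its equilibrium vectors are hyperbolic. -/
def IsMorse {D : ℕ} (f : EuclideanSpace ℝ (Fin D) → ℝ) : Prop :=
  ∀ x, IsEquilibrium f x → IsHyperbolicEquilibrium f x

/-- A stable equilibrium vector: a hyperbolic equilibrium vector at which all eigenvalues of the
(symmetric) Hessian are positive. -/
def IsStableEquilibrium {D : ℕ} (f : EuclideanSpace ℝ (Fin D) → ℝ)
    (x : EuclideanSpace ℝ (Fin D)) : Prop :=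
  IsHyperbolicEquilibrium f x ∧ ∀ c : ℝ, (hessianOp f x).HasEigenvalue c → 0 < c

/-- The basin cell of `e`: the closure of the set of initial points `x(0)` of trajectories that
converge to `e` as `t → ∞`. -/
def basinCell {D : ℕ} (f : EuclideanSpace ℝ (Fin D) → ℝ)
    (R : EuclideanSpace ℝ (Fin D) → Matrix (Fin D) (Fin D) ℝ) (e : EuclideanSpace ℝ (Fin D)) :
    Set (EuclideanSpace ℝ (Fin D)) :=
  closure {x | ∃ γ : ℝ → EuclideanSpace ℝ (Fin D),
    IsTrajectory f R γ ∧ γ 0 = x ∧ Tendsto γ atTop (𝓝 e)}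

/-- The condition number `‖A‖ ‖A⁻¹‖` of a matrix, in the operator norm of the Euclidean norm. -/
def conditionNumber {D : ℕ} (A : Matrix (Fin D) (Fin D) ℝ) : ℝ :=
  ‖Matrix.toEuclideanCLM (𝕜 := ℝ) A‖ * ‖Matrix.toEuclideanCLM (𝕜 := ℝ) A⁻¹‖

end

/-! The potential `f` decreases along trajectories, and its sublevel sets are compact because `p`
tends to `0` at infinity. So trajectories exist for all time, stay in a compact set and accumulate
only at critical points (`gradient_eq_zero_of_mapClusterPt`). Morse critical points are isolated,
which forces convergence (`exists_tendsto`). Far out `p` strictly decreases radially, so the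
critical points lie in a compact set and are finitely many.

The core is that a critical point `e` other than an SEV attracts only a null set
(`volume_attractedSet_eq_zero`). No stable manifold is constructed. Near `e` the form `⟨Hw, w⟩`,
with `H` the Hessian at `e`, does not increase along the difference `w` of two trajectories. If both
converge to `e`, the form tends to `0`, so it was nonnegative before. A set on whose differences the
form is nonnegative meets each line in a direction of negative curvature at most once, hence is null
by Fubini. The flow up to a fixed time has a locally Lipschitz inverse, so the initial points form a
null set too.

Thus almost every point is attracted by an SEV. The attracted sets of SEVs are open
(`isOpen_attractedSet`) and pairwise disjoint. Their union is dense, so the cells cover the space; a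
point of one of these open sets lies in no other cell, so cells overlap only in the exceptional null
set. -/

/-! ### Flows of globally Lipschitz fields -/

section LipschitzFields

variable {E : Type*} [NormedAddCommGroup E] [NormedSpace ℝ E] {W : E → E} {K : NNReal}

theorem IsIntegralCurveOn.reverse {γ : ℝ → E} {T : ℝ}
    (h : IsIntegralCurveOn γ (fun _ => W) (Icc 0 T)) :
    IsIntegralCurveOn (fun t => γ (T - t)) (fun _ x => -W x) (Icc 0 T) := by
  intro t ht
  have h1 := h (T - t) ⟨by linarith [ht.2], by linarith [ht.1]⟩
  have h2 : HasDerivWithinAt (fun t : ℝ => T - t) (-1) (Icc 0 T) t :=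
    ((hasDerivAt_id t).const_sub T).hasDerivWithinAt
  have h3 := h1.scomp t h2 (fun s hs => ⟨by linarith [hs.2], by linarith [hs.1]⟩)
  simpa using! h3

theorem LipschitzWith.dist_integralCurve_le (hW : LipschitzWith K W) {γ γ' : ℝ → E} {T : ℝ}
    (h : IsIntegralCurveOn γ (fun _ => W) (Icc 0 T))
    (h' : IsIntegralCurveOn γ' (fun _ => W) (Icc 0 T)) {t : ℝ} (ht : t ∈ Icc 0 T) :
    dist (γ t) (γ' t) ≤ dist (γ 0) (γ' 0) * Real.exp (K * t) := by
  have key : ∀ {α : ℝ → E}, IsIntegralCurveOn α (fun _ => W) (Icc 0 T) →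
      ∀ s ∈ Ico 0 T, HasDerivWithinAt α (W (α s)) (Ici s) s := fun hα s hs =>
    (hα s (Ico_subset_Icc_self hs)).mono_of_mem_nhdsWithin
      (mem_of_superset (Icc_mem_nhdsGE hs.2) (Icc_subset_Icc_left hs.1))
  simpa using dist_le_of_trajectories_ODE (v := fun _ => W) (fun _ => hW) h.continuousOn (key h)
    h'.continuousOn (key h') le_rfl t ht

/-- Grönwall applied to the time-reversed curves: the time-`T` flow has a Lipschitz inverse. -/
theorem LipschitzWith.dist_initial_le (hW : LipschitzWith K W) {γ γ' : ℝ → E} {T : ℝ}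
    (hT : 0 ≤ T) (h : IsIntegralCurveOn γ (fun _ => W) (Icc 0 T))
    (h' : IsIntegralCurveOn γ' (fun _ => W) (Icc 0 T)) :
    dist (γ 0) (γ' 0) ≤ dist (γ T) (γ' T) * Real.exp (K * T) := by
  simpa using hW.neg.dist_integralCurve_le h.reverse h'.reverse (right_mem_Icc.2 hT)

theorem LipschitzWith.exists_integralCurve [CompleteSpace E] (hW : LipschitzWith K W) {L : NNReal}
    (hL : ∀ x, ‖W x‖ ≤ L) (x : E) :
    ∃ γ : ℝ → E, γ 0 = x ∧ IsIntegralCurveOn γ (fun _ => W) (Ici 0) := by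
  have loc : ∀ n : ℕ, ∃ γ : ℝ → E, γ 0 = x ∧ IsIntegralCurveOn γ (fun _ => W) (Icc 0 (n : ℝ)) := by
    intro n
    have hn : (0 : ℝ) ∈ Icc 0 (n : ℝ) := ⟨le_rfl, n.cast_nonneg⟩
    -- Speed at most `L` keeps a curve within distance `L * n` of `x` up to time `n`, so the
    -- solution lives on all of `[0, n]`.
    have hP : IsPicardLindelof (fun _ => W) (⟨0, hn⟩ : Icc (0 : ℝ) n) x (L * n) 0 L K :=
      IsPicardLindelof.of_time_independent (fun y _ => hL y) hW.lipschitzOnWith (by simp)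
    exact hP.exists_eq_forall_mem_Icc_hasDerivWithinAt₀
  choose α hα0 hα using loc
  have agree : ∀ m n : ℕ, ∀ t : ℝ, 0 ≤ t → t ≤ m → t ≤ n → α m t = α n t := by
    intro m n t h0 hm hn
    have := hW.dist_integralCurve_le ((hα m).mono (Icc_subset_Icc_right hm))
      ((hα n).mono (Icc_subset_Icc_right hn)) (right_mem_Icc.2 h0)
    rw [hα0, hα0, dist_self, zero_mul] at this
    exact dist_le_zero.1 this
  -- The solutions on the intervals `[0, n]` agree on overlaps, so at time `t` any index `n ≥ t`
  -- gives the same value.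
  refine ⟨fun t => α ⌈t⌉₊ t, by simpa using hα0 0, fun t ht => ?_⟩
  obtain ⟨n, hn⟩ := exists_nat_gt t
  have ht0 : (0 : ℝ) ≤ t := ht
  have h1 : HasDerivWithinAt (α n) (W (α n t)) (Ici 0) t :=
    (hα n t ⟨ht0, hn.le⟩).mono_of_mem_nhdsWithin <| by
      have : Ici (0 : ℝ) ∩ Iic (n : ℝ) ∈ 𝓝[Ici 0] t :=
        inter_mem self_mem_nhdsWithin (mem_nhdsWithin_of_mem_nhds (Iic_mem_nhds hn))
      simpa [Ici_inter_Iic] using this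
  have e : ∀ s ∈ Ici (0 : ℝ), s ≤ n → α ⌈s⌉₊ s = α n s := fun s hs hsn =>
    agree _ _ s hs (Nat.le_ceil s) hsn
  change HasDerivWithinAt (fun t => α ⌈t⌉₊ t) (W (α ⌈t⌉₊ t)) (Ici 0) t
  rw [e t ht hn.le]
  refine h1.congr_of_eventuallyEq ?_ (e t ht hn.le)
  filter_upwards [self_mem_nhdsWithin, mem_nhdsWithin_of_mem_nhds (Iic_mem_nhds hn)] with s hs hsn
  exact e s hs hsn

end LipschitzFields

/-! ### Null sets under Lipschitz maps and quadratic forms -/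

section NullSets

variable {E : Type*} [NormedAddCommGroup E] [InnerProductSpace ℝ E] [FiniteDimensional ℝ E]
  [MeasurableSpace E] [BorelSpace E]

/-- Hausdorff measure in the full dimension has the same null sets as volume and scales under
Lipschitz maps. -/
theorem measure_image_eq_zero_of_lipschitzOnWith {C : NNReal} {g : E → E} {s : Set E}
    (hg : LipschitzOnWith C g s) (hs : volume s = 0) : volume (g '' s) = 0 := by
  have h1 : (volume : Measure E) ≪ Measure.hausdorffMeasure (Module.finrank ℝ E : ℝ) :=
    Measure.absolutelyContinuous_isAddHaarMeasure _ _
  have h2 : (Measure.hausdorffMeasure (Module.finrank ℝ E : ℝ) : Measure E) ≪ volume :=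
    Measure.absolutelyContinuous_isAddHaarMeasure _ _
  apply h1
  refine le_antisymm ((hg.hausdorffMeasure_image_le (Nat.cast_nonneg _)).trans ?_) zero_le
  rw [h2 hs, mul_zero]

theorem measure_eq_zero_of_dist_le_mul_dist {C : NNReal} {Φ : E → E} {s : Set E}
    (h : ∀ x ∈ s, ∀ y ∈ s, dist x y ≤ C * dist (Φ x) (Φ y)) (hs : volume (Φ '' s) = 0) :
    volume s = 0 := by
  have hinj : InjOn Φ s := fun x hx y hy hxy => by
    have := h x hx y hy
    rw [hxy, dist_self, mul_zero] at this
    exact dist_le_zero.1 this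
  have hg : LipschitzOnWith C (Function.invFunOn Φ s) (Φ '' s) := by
    refine LipschitzOnWith.of_dist_le_mul ?_
    rintro _ ⟨x, hx, rfl⟩ _ ⟨y, hy, rfl⟩
    rw [hinj.leftInvOn_invFunOn hx, hinj.leftInvOn_invFunOn hy]
    exact h x hx y hy
  have := measure_image_eq_zero_of_lipschitzOnWith hg hs
  rwa [hinj.invFunOn_image subset_rfl] at this

/-- A set in which a quadratic form is nonnegative on all differences is null if the form takes a
negative value. -/
theorem measure_eq_zero_of_inner_sub_nonneg (H : E →L[ℝ] E) {u : E} (hu : inner ℝ (H u) u < 0)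
    {s : Set E} (hs : ∀ x ∈ s, ∀ y ∈ s, 0 ≤ inner ℝ (H (x - y)) (x - y)) : volume s = 0 := by
  -- The condition passes to the closure, which is measurable, as the Fubini argument needs.
  have hcl : ∀ x ∈ closure s, ∀ y ∈ closure s, 0 ≤ inner ℝ (H (x - y)) (x - y) := by
    have hc : IsClosed {p : E × E | 0 ≤ inner ℝ (H (p.1 - p.2)) (p.1 - p.2)} :=
      isClosed_le continuous_const (by fun_prop)
    have : closure s ×ˢ closure s ⊆ {p : E × E | 0 ≤ inner ℝ (H (p.1 - p.2)) (p.1 - p.2)} := by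
      rw [← closure_prod_eq]
      exact closure_minimal (fun p hp => hs _ hp.1 _ hp.2) hc
    exact fun x hx y hy => this (mk_mem_prod hx hy)
  refine measure_mono_null subset_closure ?_
  have hae : ∀ᵐ y ∂(volume : Measure E), y ∈ (closure s)ᶜ := by
    refine ae_mem_of_ae_add_linearMap_mem (LinearMap.toSpanSingleton ℝ E u) (volume : Measure ℝ) _
      isClosed_closure.measurableSet.compl fun y => ?_
    have hsub : {t : ℝ | y + t • u ∈ closure s}.Subsingleton := by
      intro a ha b hb
      by_contra hab
      have h1 := hcl _ ha _ hb
      have h2 : y + a • u - (y + b • u) = (a - b) • u := by module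
      rw [h2, map_smul, real_inner_smul_left, real_inner_smul_right, ← mul_assoc] at h1
      have h3 : 0 < (a - b) * (a - b) := mul_self_pos.2 (sub_ne_zero.2 hab)
      nlinarith
    simpa [ae_iff] using! hsub.measure_zero volume
  simpa [ae_iff] using hae

end NullSets

/-! ### Existence, uniqueness and convergence for proper gradient systems -/

section GradientSystems

variable {E : Type*} [NormedAddCommGroup E] [InnerProductSpace ℝ E] [FiniteDimensional ℝ E]

/-- The vector field `x ↦ -A(x) ∇f(x)`. -/
noncomputable def descentField (f : E → ℝ) (A : E → E →L[ℝ] E) (x : E) : E := -A x (gradient f x)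

/-- The data of a gradient-like system `x' = -A(x) ∇f(x)`: the potential `f` has compact sublevel
sets and the operators `A(x)` are positive. -/
structure IsProperGradientSystem (f : E → ℝ) (A : E → E →L[ℝ] E) : Prop where
  contDiff_potential : ContDiff ℝ 2 f
  contDiff_operator : ContDiff ℝ 1 A
  inner_pos : ∀ x v, v ≠ 0 → 0 < inner ℝ (A x v) v
  isCompact_sublevel : ∀ c, IsCompact {x | f x ≤ c}

variable {f : E → ℝ} {A : E → E →L[ℝ] E}

theorem ContDiff.gradient (hf : ContDiff ℝ 2 f) : ContDiff ℝ 1 (gradient f) :=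
  (InnerProductSpace.toDual ℝ E).symm.toContinuousLinearEquiv.contDiff.comp
    (hf.fderiv_right (m := 1) (by norm_num))

namespace IsProperGradientSystem

variable (S : IsProperGradientSystem f A)

include S

omit [FiniteDimensional ℝ E] in
theorem continuous_potential : Continuous f := S.contDiff_potential.continuous

omit [FiniteDimensional ℝ E] in
theorem hasFDerivAt (x : E) : HasFDerivAt f (fderiv ℝ f x) x :=
  (S.contDiff_potential.differentiable (by norm_num) x).hasFDerivAt

theorem contDiff_descentField : ContDiff ℝ 1 (descentField f A) :=
  (S.contDiff_operator.clm_apply S.contDiff_potential.gradient).neg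

omit S in
theorem fderiv_descentField_eq (x : E) :
    fderiv ℝ f x (descentField f A x) = -inner ℝ (A x (gradient f x)) (gradient f x) := by
  rw [descentField, map_neg, ← inner_gradient_left, real_inner_comm]

theorem fderiv_descentField_nonpos (x : E) : fderiv ℝ f x (descentField f A x) ≤ 0 := by
  rw [fderiv_descentField_eq, neg_nonpos]
  by_cases h : gradient f x = 0
  · simp [h]
  · exact (S.inner_pos x _ h).le

theorem fderiv_descentField_neg {x : E} (h : gradient f x ≠ 0) :
    fderiv ℝ f x (descentField f A x) < 0 := by
  rw [fderiv_descentField_eq, neg_lt_zero]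
  exact S.inner_pos x _ h

/-- Allowing nonnegative multiples of the field lets this apply to cut-off fields before their
curves are known to be trajectories. -/
theorem antitoneOn_comp {W : E → E} (hW : ∀ x, ∃ a : ℝ, 0 ≤ a ∧ W x = a • descentField f A x)
    {γ : ℝ → E} (hγ : IsIntegralCurveOn γ (fun _ => W) (Ici 0)) :
    AntitoneOn (fun t => f (γ t)) (Ici 0) := by
  have hd : ∀ t ∈ Ioi (0 : ℝ), HasDerivAt (fun t => f (γ t)) (fderiv ℝ f (γ t) (W (γ t))) t :=
    fun t ht => (S.hasFDerivAt _).comp_hasDerivAt t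
      (hγ.isIntegralCurveAt (Ici_mem_nhds ht)).hasDerivAt
  refine antitoneOn_of_deriv_nonpos (convex_Ici 0)
    (S.continuous_potential.comp_continuousOn hγ.continuousOn) ?_ ?_
  · rw [interior_Ici]
    exact fun t ht => (hd t ht).differentiableAt.differentiableWithinAt
  · rw [interior_Ici]
    intro t ht
    rw [(hd t ht).deriv]
    obtain ⟨a, ha, hWa⟩ := hW (γ t)
    rw [hWa, map_smul]
    exact mul_nonpos_of_nonneg_of_nonpos ha (S.fderiv_descentField_nonpos _)

theorem antitoneOn {γ : ℝ → E} (hγ : IsIntegralCurveOn γ (fun _ => descentField f A) (Ici 0)) :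
    AntitoneOn (fun t => f (γ t)) (Ici 0) :=
  S.antitoneOn_comp (fun _ => ⟨1, zero_le_one, (one_smul _ _).symm⟩) hγ

theorem exists_cutoff (c : ℝ) : ∃ (W : E → E) (K L : NNReal), LipschitzWith K W ∧
    (∀ x, ‖W x‖ ≤ L) ∧ (∀ x, f x ≤ c → W x = descentField f A x) ∧
    ∀ x, ∃ a : ℝ, 0 ≤ a ∧ W x = a • descentField f A x := by
  obtain ⟨r, hr⟩ := (S.isCompact_sublevel c).isBounded.subset_closedBall 0
  -- The maximum with `1` only makes the inner radius positive.
  let χ : ContDiffBump (0 : E) :=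
    ⟨max r 1, max r 1 + 1, lt_max_of_lt_right one_pos, lt_add_one _⟩
  have hW : ContDiff ℝ 1 (fun x => χ x • descentField f A x) :=
    χ.contDiff.smul S.contDiff_descentField
  have hc : HasCompactSupport (fun x => χ x • descentField f A x) := χ.hasCompactSupport.smul_right
  obtain ⟨K, hK⟩ := hW.lipschitzWith_of_hasCompactSupport hc one_ne_zero
  obtain ⟨L, hL⟩ := hc.exists_bound_of_continuous hW.continuous
  refine ⟨_, K, L.toNNReal, hK, fun x => (hL x).trans (Real.le_coe_toNNReal L), fun x hx => ?_,
    fun x => ⟨χ x, χ.nonneg, rfl⟩⟩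
  have : χ x = 1 := χ.one_of_mem_closedBall
    (Metric.closedBall_subset_closedBall (le_max_left _ _) (hr hx))
  simp [this]

/-- A curve of the cut-off field cannot leave the sublevel set of its starting point, and there the
two fields coincide. -/
theorem exists_trajectory (x : E) :
    ∃ γ, IsIntegralCurveOn γ (fun _ => descentField f A) (Ici 0) ∧ γ 0 = x := by
  obtain ⟨W, K, L, hK, hL, heq, hpos⟩ := S.exists_cutoff (f x)
  obtain ⟨γ, h0, hγ⟩ := hK.exists_integralCurve hL x
  refine ⟨γ, fun t ht => ?_, h0⟩
  have h1 : f (γ t) ≤ f x := by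
    simpa [h0] using S.antitoneOn_comp hpos hγ self_mem_Ici ht ht
  simpa only [heq _ h1] using hγ t ht

theorem exists_dist_le (c : ℝ) : ∃ K : NNReal, ∀ γ γ' : ℝ → E,
    IsIntegralCurveOn γ (fun _ => descentField f A) (Ici 0) →
    IsIntegralCurveOn γ' (fun _ => descentField f A) (Ici 0) → f (γ 0) ≤ c → f (γ' 0) ≤ c →
    ∀ t, 0 ≤ t → dist (γ t) (γ' t) ≤ dist (γ 0) (γ' 0) * Real.exp (K * t) ∧
      dist (γ 0) (γ' 0) ≤ dist (γ t) (γ' t) * Real.exp (K * t) := by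
  obtain ⟨W, K, L, hK, hL, heq, hpos⟩ := S.exists_cutoff c
  have key : ∀ {γ : ℝ → E}, IsIntegralCurveOn γ (fun _ => descentField f A) (Ici 0) →
      f (γ 0) ≤ c → IsIntegralCurveOn γ (fun _ => W) (Ici 0) := by
    intro γ hγ h0 t ht
    have := heq _ ((S.antitoneOn hγ self_mem_Ici ht ht).trans h0)
    simpa only [this] using hγ t ht
  refine ⟨K, fun γ γ' hγ hγ' h0 h0' t ht => ?_⟩
  have h1 := (key hγ h0).mono (Icc_subset_Ici_self : Icc 0 t ⊆ Ici 0)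
  have h2 := (key hγ' h0').mono (Icc_subset_Ici_self : Icc 0 t ⊆ Ici 0)
  exact ⟨hK.dist_integralCurve_le h1 h2 (right_mem_Icc.2 ht), hK.dist_initial_le ht h1 h2⟩

theorem trajectory_unique {γ γ' : ℝ → E}
    (hγ : IsIntegralCurveOn γ (fun _ => descentField f A) (Ici 0))
    (hγ' : IsIntegralCurveOn γ' (fun _ => descentField f A) (Ici 0)) (h0 : γ 0 = γ' 0) :
    EqOn γ γ' (Ici 0) := by
  obtain ⟨K, hK⟩ := S.exists_dist_le (f (γ 0))
  intro t ht
  have := (hK γ γ' hγ hγ' le_rfl (h0 ▸ le_rfl) t ht).1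
  rw [h0, dist_self, zero_mul] at this
  exact dist_le_zero.1 this

theorem isBounded_trajectory {γ : ℝ → E}
    (hγ : IsIntegralCurveOn γ (fun _ => descentField f A) (Ici 0)) :
    Bornology.IsBounded (γ '' Ici 0) := by
  refine (S.isCompact_sublevel (f (γ 0))).isBounded.subset ?_
  rintro _ ⟨t, ht, rfl⟩
  exact S.antitoneOn hγ self_mem_Ici ht ht

omit S [FiniteDimensional ℝ E] in
theorem _root_.IsIntegralCurveOn.shift {W : E → E} {γ : ℝ → E}
    (hγ : IsIntegralCurveOn γ (fun _ => W) (Ici 0)) {s : ℝ} (hs : 0 ≤ s) :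
    IsIntegralCurveOn (fun t => γ (t + s)) (fun _ => W) (Ici 0) := by
  intro t ht
  have h1 := hγ (t + s) (add_nonneg ht hs)
  have h2 : HasDerivWithinAt (fun t : ℝ => t + s) 1 (Ici 0) t :=
    ((hasDerivAt_id t).add_const s).hasDerivWithinAt
  simpa using! h1.scomp t h2 (fun r hr => add_nonneg hr hs)

theorem exists_lt_of_gradient_ne_zero {γ : ℝ → E}
    (hγ : IsIntegralCurveOn γ (fun _ => descentField f A) (Ici 0)) (h0 : gradient f (γ 0) ≠ 0) :
    ∃ s, 0 ≤ s ∧ f (γ s) < f (γ 0) := by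
  by_contra! hcon
  have hconst : ∀ s ∈ Ici (0 : ℝ), f (γ s) = f (γ 0) := fun s hs =>
    le_antisymm (S.antitoneOn hγ self_mem_Ici hs hs) (hcon s hs)
  have h1 : HasDerivWithinAt (fun t => f (γ t)) (fderiv ℝ f (γ 0) (descentField f A (γ 0)))
      (Ici 0) 0 := (S.hasFDerivAt _).comp_hasDerivWithinAt 0 (hγ 0 self_mem_Ici)
  have h2 : HasDerivWithinAt (fun t => f (γ t)) 0 (Ici 0) 0 :=
    (hasDerivWithinAt_const (0 : ℝ) (Ici 0) (f (γ 0))).congr hconst rfl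
  exact (S.fderiv_descentField_neg h0).ne
    (((uniqueDiffOn_Ici (0 : ℝ)) 0 self_mem_Ici).eq_deriv _ h1 h2)

/-- LaSalle's argument: `f z` bounds `f` from below along `γ`. Were `z` not critical, the trajectory
from `z` would fall below `f z`, and by continuous dependence so would `γ` after passing close to
`z`. -/
theorem gradient_eq_zero_of_mapClusterPt {γ : ℝ → E} {z : E}
    (hγ : IsIntegralCurveOn γ (fun _ => descentField f A) (Ici 0))
    (hz : MapClusterPt z atTop γ) : gradient f z = 0 := by
  have hlow : ∀ t, 0 ≤ t → f z ≤ f (γ t) := by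
    intro t ht
    have hc : IsClosed {y | f y ≤ f (γ t)} := isClosed_le S.continuous_potential continuous_const
    refine hc.mem_of_mapClusterPt hz ?_
    filter_upwards [eventually_ge_atTop t] with s hs
    exact S.antitoneOn hγ ht (ht.trans hs) hs
  by_contra hne
  obtain ⟨ψ, hψ, hψ0⟩ := S.exists_trajectory z
  obtain ⟨s, hs, hlt⟩ := S.exists_lt_of_gradient_ne_zero hψ (by rwa [hψ0])
  rw [hψ0] at hlt
  obtain ⟨K, hK⟩ := S.exists_dist_le (max (f (γ 0)) (f z))
  have hopen : {y | f y < f z} ∈ 𝓝 (ψ s) :=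
    (isOpen_lt S.continuous_potential continuous_const).mem_nhds hlt
  obtain ⟨ε, hε, hball⟩ := Metric.mem_nhds_iff.1 hopen
  have hfreq := hz.frequently (Metric.ball_mem_nhds z (div_pos hε (Real.exp_pos (K * s))))
  obtain ⟨t, ht, ht0⟩ := (hfreq.and_eventually (eventually_ge_atTop 0)).exists
  have h1 := (hK _ ψ (hγ.shift ht0) hψ (by
    simpa using Or.inl (S.antitoneOn hγ self_mem_Ici ht0 ht0)) (by simp [hψ0]) s hs).1
  rw [zero_add, hψ0] at h1
  have h2 : dist (γ (s + t)) (ψ s) < ε :=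
    h1.trans_lt ((lt_div_iff₀ (Real.exp_pos _)).1 ht)
  exact absurd (hlow (s + t) (add_nonneg hs ht0)) (not_le.2 (hball h2))

theorem exists_tendsto (hiso : ∀ z, gradient f z = 0 → ∀ᶠ y in 𝓝[≠] z, gradient f y ≠ 0)
    {γ : ℝ → E} (hγ : IsIntegralCurveOn γ (fun _ => descentField f A) (Ici 0)) :
    ∃ e, gradient f e = 0 ∧ Tendsto γ atTop (𝓝 e) := by
  obtain ⟨e, -, he⟩ := (S.isCompact_sublevel (f (γ 0))).exists_mapClusterPt_of_frequently
    (l := atTop) (f := γ) (by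
      refine Eventually.frequently ?_
      filter_upwards [eventually_ge_atTop 0] with t ht
      exact S.antitoneOn hγ self_mem_Ici ht ht)
  have he0 := S.gradient_eq_zero_of_mapClusterPt hγ he
  refine ⟨e, he0, ?_⟩
  obtain ⟨ρ, hρ, hball⟩ := Metric.mem_nhdsWithin_iff.1 (hiso e he0)
  rw [Metric.tendsto_nhds]
  intro ε' hε'
  obtain ⟨ε, hε, hεε', hερ⟩ : ∃ ε > 0, ε ≤ ε' ∧ ε < ρ :=
    ⟨min ε' (ρ / 2), by positivity, min_le_left _ _, (min_le_right _ _).trans_lt (half_lt_self hρ)⟩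
  -- A small sphere about `e` contains no critical point, hence no cluster point, so `γ` eventually
  -- avoids it. Having entered the ball after that, it cannot leave.
  have hne : ∀ᶠ t in atTop, dist (γ t) e ≠ ε := by
    by_contra hcon
    rw [not_eventually] at hcon
    simp only [not_not] at hcon
    obtain ⟨z, hz, hzc⟩ := (isCompact_sphere e ε).exists_mapClusterPt_of_frequently
      (l := atTop) (f := γ) hcon
    have hz' : dist z e = ε := hz
    exact hball ⟨by rw [Metric.mem_ball, hz']; exact hερ, fun h => by
      rw [mem_singleton_iff.1 h, dist_self] at hz'; exact hε.ne hz'⟩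
      (S.gradient_eq_zero_of_mapClusterPt hγ hzc)
  obtain ⟨T, hT⟩ := eventually_atTop.1 (hne.and (eventually_ge_atTop 0))
  obtain ⟨t₀, ht₀, hT₀⟩ :=
    ((he.frequently (Metric.ball_mem_nhds e hε)).and_eventually (eventually_ge_atTop T)).exists
  filter_upwards [eventually_ge_atTop t₀] with t ht
  refine lt_of_lt_of_le ?_ hεε'
  by_contra! hge
  have hcont : ContinuousOn (fun s => dist (γ s) e) (Icc t₀ t) :=
    (continuous_id.dist continuous_const).comp_continuousOn
      (hγ.continuousOn.mono fun s hs => (hT T le_rfl).2.trans (hT₀.trans hs.1))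
  obtain ⟨s, hs, hse⟩ := intermediate_value_Icc ht hcont ⟨le_of_lt ht₀, hge⟩
  exact (hT s (hT₀.trans hs.1)).1 hse

end IsProperGradientSystem

end GradientSystems

/-! ### Local dynamics at nondegenerate critical points -/

section CriticalPoints

variable {E : Type*} [NormedAddCommGroup E] [InnerProductSpace ℝ E] [FiniteDimensional ℝ E]

theorem exists_mul_sq_norm_le_inner (T : E →L[ℝ] E) (hT : ∀ v, v ≠ 0 → 0 < inner ℝ (T v) v) :
    ∃ c > 0, ∀ v, c * ‖v‖ ^ 2 ≤ inner ℝ (T v) v := by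
  rcases subsingleton_or_nontrivial E with hE | hE
  · exact ⟨1, one_pos, fun v => by simp [Subsingleton.elim v 0]⟩
  obtain ⟨w, hw, hmin⟩ := (isCompact_sphere (0 : E) 1).exists_isMinOn
    (NormedSpace.sphere_nonempty.2 zero_le_one)
    (f := fun v => inner ℝ (T v) v) (by fun_prop)
  have hw0 : w ≠ 0 := ne_zero_of_mem_unit_sphere (⟨w, hw⟩ : Metric.sphere (0 : E) 1)
  refine ⟨_, hT w hw0, fun v => ?_⟩
  rcases eq_or_ne v 0 with rfl | hv
  · simp
  have hv' : 0 < ‖v‖ := norm_pos_iff.2 hv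
  have h1 : inner ℝ (T w) w ≤ inner ℝ (T (‖v‖⁻¹ • v)) (‖v‖⁻¹ • v) :=
    isMinOn_iff.1 hmin _ (by simp [norm_smul, hv'.ne'])
  rw [map_smul, real_inner_smul_left, real_inner_smul_right, ← mul_assoc] at h1
  calc inner ℝ (T w) w * ‖v‖ ^ 2 ≤ ‖v‖⁻¹ * ‖v‖⁻¹ * inner ℝ (T v) v * ‖v‖ ^ 2 := by gcongr
    _ = inner ℝ (T v) v := by field_simp

theorem inner_fderiv_gradient_symm {f : E → ℝ} (hf : ContDiff ℝ 2 f) (e v w : E) :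
    inner ℝ (fderiv ℝ (gradient f) e v) w = inner ℝ v (fderiv ℝ (gradient f) e w) := by
  have h1 : ∀ v w, inner ℝ (fderiv ℝ (gradient f) e v) w = fderiv ℝ (fderiv ℝ f) e v w := by
    intro v w
    have hd : HasFDerivAt (fderiv ℝ f) (fderiv ℝ (fderiv ℝ f) e) e :=
      ((hf.fderiv_right (m := 1) (by norm_num)).differentiable (by norm_num) e).hasFDerivAt
    have h2 : HasFDerivAt (gradient f) _ e :=
      (InnerProductSpace.toDual ℝ E).symm.toContinuousLinearEquiv.hasFDerivAt.comp e hd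
    rw [h2.fderiv]
    exact InnerProductSpace.toDual_symm_apply
  rw [h1, real_inner_comm, h1]
  exact (hf.contDiffAt.isSymmSndFDerivAt (by simp)).eq v w

theorem eventually_gradient_ne_zero {f : E → ℝ} (hf : ContDiff ℝ 2 f) {e : E}
    (he : Function.Injective (fderiv ℝ (gradient f) e)) :
    ∀ᶠ y in 𝓝[≠] e, gradient f y ≠ 0 := by
  have hd : HasFDerivAt (gradient f) (fderiv ℝ (gradient f) e) e :=
    (hf.gradient.differentiable one_ne_zero e).hasFDerivAt
  obtain ⟨C, -, hC⟩ := LinearMap.exists_antilipschitzWith (fderiv ℝ (gradient f) e : E →ₗ[ℝ] E)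
    (LinearMap.ker_eq_bot.2 he)
  exact hd.eventually_ne ⟨C, hC⟩

namespace IsProperGradientSystem

variable {f : E → ℝ} {A : E → E →L[ℝ] E} (S : IsProperGradientSystem f A) {e : E}

include S

theorem hasFDerivAt_descentField (he : gradient f e = 0) :
    HasFDerivAt (descentField f A) (-(A e ∘L fderiv ℝ (gradient f) e)) e := by
  have h1 := (S.contDiff_operator.differentiable one_ne_zero e).hasFDerivAt.clm_apply
    (S.contDiff_potential.gradient.differentiable one_ne_zero e).hasFDerivAt
  convert! h1.neg using 2
  simp [he]

/-- Near a nondegenerate critical point the Hessian form decreases along differences of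
trajectories. -/
theorem exists_inner_descentField_sub_nonpos (he : gradient f e = 0)
    (hinj : Function.Injective (fderiv ℝ (gradient f) e)) :
    ∃ r > 0, ∀ x ∈ Metric.ball e r, ∀ y ∈ Metric.ball e r,
      inner ℝ (fderiv ℝ (gradient f) e (x - y)) (descentField f A x - descentField f A y) ≤ 0 := by
  set H := fderiv ℝ (gradient f) e with hH
  -- The linearized field is `-A H`, so the leading term is `-⟨A H w, H w⟩`, negative definite
  -- because `H` is injective.
  obtain ⟨c, hc, hcoer⟩ := exists_mul_sq_norm_le_inner
    (ContinuousLinearMap.adjoint H ∘L A e ∘L H) fun v hv => by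
      simpa [ContinuousLinearMap.adjoint_inner_left] using
        S.inner_pos e (H v) ((map_ne_zero_iff H hinj).2 hv)
  have hs : HasStrictFDerivAt (descentField f A) (-(A e ∘L H)) e := by
    have := S.contDiff_descentField.contDiffAt.hasStrictFDerivAt (x := e) one_ne_zero
    rwa [(S.hasFDerivAt_descentField he).fderiv] at this
  -- Chosen so that the remainder contributes at most `c * ‖w‖ ^ 2`; the `+ 1` avoids dividing by
  -- zero.
  have hε : 0 < c / (‖H‖ + 1) := by positivity
  obtain ⟨r, hr, hball⟩ := Metric.eventually_nhds_iff_ball.1 (hs.isLittleO.def hε)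
  refine ⟨r, hr, fun x hx y hy => ?_⟩
  have h1 := hball (x, y) (by rw [← ball_prod_same]; exact ⟨hx, hy⟩)
  simp only at h1
  set w := x - y
  set ρ := descentField f A x - descentField f A y - (-(A e ∘L H)) w with hρ
  have h2 : descentField f A x - descentField f A y = ρ - A e (H w) := by
    rw [hρ]; simp
  have h3 : inner ℝ (H w) ρ ≤ c * ‖w‖ ^ 2 := by
    calc inner ℝ (H w) ρ ≤ ‖H w‖ * ‖ρ‖ := real_inner_le_norm _ _
      _ ≤ (‖H‖ + 1) * ‖w‖ * (c / (‖H‖ + 1) * ‖w‖) := by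
        gcongr
        exact (H.le_opNorm w).trans (by gcongr; linarith)
      _ = c * ‖w‖ ^ 2 := by field_simp
  have h4 := hcoer w
  simp only [ContinuousLinearMap.comp_apply, ContinuousLinearMap.adjoint_inner_left] at h4
  rw [h2, inner_sub_right, real_inner_comm (A e (H w))]
  linarith

theorem antitoneOn_inner_sub {r : ℝ} (hr : ∀ x ∈ Metric.ball e r, ∀ y ∈ Metric.ball e r,
      inner ℝ (fderiv ℝ (gradient f) e (x - y)) (descentField f A x - descentField f A y) ≤ 0)
    {γ γ' : ℝ → E} {s : Set ℝ} (hs : Convex ℝ s) (hs0 : s ⊆ Ici 0)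
    (hγ : IsIntegralCurveOn γ (fun _ => descentField f A) (Ici 0))
    (hγ' : IsIntegralCurveOn γ' (fun _ => descentField f A) (Ici 0))
    (hm : ∀ t ∈ s, γ t ∈ Metric.ball e r) (hm' : ∀ t ∈ s, γ' t ∈ Metric.ball e r) :
    AntitoneOn (fun t => inner ℝ (fderiv ℝ (gradient f) e (γ t - γ' t)) (γ t - γ' t)) s := by
  have hd : ∀ t ∈ interior s, HasDerivAt (fun t => inner ℝ (fderiv ℝ (gradient f) e (γ t - γ' t))
      (γ t - γ' t)) (2 * inner ℝ (fderiv ℝ (gradient f) e (γ t - γ' t))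
        (descentField f A (γ t) - descentField f A (γ' t))) t := by
    intro t ht
    have ht0 : Ici (0 : ℝ) ∈ 𝓝 t := mem_of_superset (mem_interior_iff_mem_nhds.1 ht) hs0
    have h1 := (hγ.isIntegralCurveAt ht0).hasDerivAt.sub (hγ'.isIntegralCurveAt ht0).hasDerivAt
    have h2 := ((fderiv ℝ (gradient f) e).hasFDerivAt.comp_hasDerivAt t h1).inner ℝ h1
    convert! h2 using 1
    simp only [Function.comp_apply, Pi.sub_apply]
    rw [inner_fderiv_gradient_symm S.contDiff_potential e (_ - descentField f A (γ' t)),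
      real_inner_comm _ (descentField f A (γ t) - _), two_mul]
  have hsub : ContinuousOn (fun t => γ t - γ' t) s :=
    (hγ.continuousOn.mono hs0).sub (hγ'.continuousOn.mono hs0)
  refine antitoneOn_of_deriv_nonpos hs
    (((fderiv ℝ (gradient f) e).continuous.comp_continuousOn hsub).inner hsub)
    (fun t ht => (hd t ht).differentiableAt.differentiableWithinAt) fun t ht => ?_
  rw [(hd t ht).deriv]
  have := hr _ (hm t (interior_subset ht)) _ (hm' t (interior_subset ht))
  linarith

omit S in
/-- The set of initial points of trajectories that converge to `e`. -/
def _root_.attractedSet (f : E → ℝ) (A : E → E →L[ℝ] E) (e : E) : Set E :=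
  {x | ∃ γ : ℝ → E, IsIntegralCurveOn γ (fun _ => descentField f A) (Ici 0) ∧ γ 0 = x ∧
    Tendsto γ atTop (𝓝 e)}

/-- The stable set of a nondegenerate critical point that has a descent direction is null. -/
theorem volume_attractedSet_eq_zero [MeasurableSpace E] [BorelSpace E] (he : gradient f e = 0)
    (hinj : Function.Injective (fderiv ℝ (gradient f) e)) {u : E}
    (hu : inner ℝ (fderiv ℝ (gradient f) e u) u < 0) : volume (attractedSet f A e) = 0 := by
  obtain ⟨r, hr, hdec⟩ := S.exists_inner_descentField_sub_nonpos he hinj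
  choose φ hφ hφ0 using S.exists_trajectory
  -- A single `n` bounds both the initial energy, giving a uniform Lipschitz constant, and the time
  -- after which the trajectory stays near `e`.
  have hcover : attractedSet f A e ⊆ ⋃ n : ℕ, {x | f x ≤ n ∧
      (∀ t ∈ Ici (n : ℝ), φ x t ∈ Metric.ball e r) ∧ Tendsto (φ x) atTop (𝓝 e)} := by
    rintro x ⟨γ, hγ, h0, hlim⟩
    have heq : EqOn γ (φ x) (Ici 0) := S.trajectory_unique hγ (hφ x) (by rw [h0, hφ0])
    have hlim' : Tendsto (φ x) atTop (𝓝 e) :=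
      hlim.congr' ((eventually_ge_atTop 0).mono fun t ht => heq ht)
    obtain ⟨T, hT⟩ := eventually_atTop.1 (hlim'.eventually (Metric.ball_mem_nhds e hr))
    obtain ⟨n, hn⟩ := exists_nat_ge (max T (f x))
    exact mem_iUnion.2 ⟨n, (le_max_right _ _).trans hn,
      fun t ht => hT t (((le_max_left _ _).trans hn).trans ht), hlim'⟩
  refine measure_mono_null hcover (measure_iUnion_null fun n => ?_)
  obtain ⟨K, hK⟩ := S.exists_dist_le n
  refine measure_eq_zero_of_dist_le_mul_dist (Φ := fun x => φ x n)
    (C := (Real.exp (K * n)).toNNReal) (fun x hx y hy => ?_) ?_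
  · have := (hK _ _ (hφ x) (hφ y) (by rw [hφ0]; exact hx.1) (by rw [hφ0]; exact hy.1) n
      n.cast_nonneg).2
    rw [hφ0, hφ0] at this
    rwa [Real.coe_toNNReal _ (Real.exp_pos _).le, mul_comm]
  · refine measure_eq_zero_of_inner_sub_nonneg _ hu ?_
    rintro _ ⟨x, ⟨-, hx, hxe⟩, rfl⟩ _ ⟨y, ⟨-, hy, hye⟩, rfl⟩
    have hanti := S.antitoneOn_inner_sub hdec (convex_Ici (n : ℝ))
      (Ici_subset_Ici.2 n.cast_nonneg) (hφ x) (hφ y) hx hy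
    have hw : Tendsto (fun t => φ x t - φ y t) atTop (𝓝 0) := by simpa using hxe.sub hye
    have hlim : Tendsto (fun t => inner ℝ (fderiv ℝ (gradient f) e (φ x t - φ y t))
        (φ x t - φ y t)) atTop (𝓝 0) := by
      simpa using Tendsto.inner (𝕜 := ℝ) (((fderiv ℝ (gradient f) e).continuous.tendsto 0).comp hw) hw
    refine le_of_tendsto hlim ?_
    filter_upwards [eventually_ge_atTop (n : ℝ)] with t ht
    exact hanti self_mem_Ici ht ht

/-- The Hessian form at `γ t - e` is a Lyapunov function, as seen by comparing `γ` with the constant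
trajectory `e`. It is at least `c * ρ ^ 2` on the sphere of radius `ρ`, so starting below this value
prevents a first arrival there. -/
theorem exists_nhds_tendsto (hiso : ∀ z, gradient f z = 0 → ∀ᶠ y in 𝓝[≠] z, gradient f y ≠ 0)
    (he : gradient f e = 0)
    (hpos : ∀ v, v ≠ 0 → 0 < inner ℝ (fderiv ℝ (gradient f) e v) v) :
    ∃ U ∈ 𝓝 e, ∀ γ : ℝ → E, IsIntegralCurveOn γ (fun _ => descentField f A) (Ici 0) →
      γ 0 ∈ U → Tendsto γ atTop (𝓝 e) := by
  have hinj : Function.Injective (fderiv ℝ (gradient f) e) := by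
    refine (injective_iff_map_eq_zero _).2 fun v hv => ?_
    by_contra hne
    simpa [hv] using hpos v hne
  obtain ⟨r, hr, hdec⟩ := S.exists_inner_descentField_sub_nonpos he hinj
  obtain ⟨c, hc, hcoer⟩ := exists_mul_sq_norm_le_inner _ hpos
  obtain ⟨r', hr', hball⟩ := Metric.mem_nhdsWithin_iff.1 (hiso e he)
  obtain ⟨ρ, hρ, hρr, hρr'⟩ : ∃ ρ > 0, ρ < r ∧ ρ < r' :=
    ⟨min r r' / 2, by positivity,
      (half_lt_self (lt_min hr hr')).trans_le (min_le_left _ _),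
      (half_lt_self (lt_min hr hr')).trans_le (min_le_right _ _)⟩
  have hconst : IsIntegralCurveOn (fun _ => e) (fun _ => descentField f A) (Ici 0) := by
    intro t _
    simpa [descentField, he] using hasDerivWithinAt_const t (Ici (0 : ℝ)) e
  refine ⟨Metric.ball e ρ ∩ {x | inner ℝ (fderiv ℝ (gradient f) e (x - e)) (x - e) < c * ρ ^ 2},
    inter_mem (Metric.ball_mem_nhds e hρ) ((isOpen_lt (by fun_prop) continuous_const).mem_nhds
      (by simpa using mul_pos hc (pow_pos hρ 2))), fun γ hγ h0 => ?_⟩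
  have hstay : ∀ t, 0 ≤ t → γ t ∈ Metric.closedBall e ρ := by
    by_contra! hcon
    obtain ⟨t, ht, hout⟩ := hcon
    have hcont : ContinuousOn (fun s => dist (γ s) e) (Icc 0 t) :=
      (continuous_id.dist continuous_const).comp_continuousOn
        (hγ.continuousOn.mono Icc_subset_Ici_self)
    have hout' : ρ < dist (γ t) e := not_le.1 hout
    have hne : (Icc 0 t ∩ (fun s => dist (γ s) e) ⁻¹' {ρ}).Nonempty := by
      obtain ⟨s, hs, hse⟩ := intermediate_value_Icc ht hcont ⟨le_of_lt h0.1, hout'.le⟩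
      exact ⟨s, hs, hse⟩
    have hcl : IsCompact (Icc 0 t ∩ (fun s => dist (γ s) e) ⁻¹' {ρ}) :=
      isCompact_Icc.of_isClosed_subset
        (hcont.preimage_isClosed_of_isClosed isClosed_Icc isClosed_singleton) inter_subset_left
    obtain ⟨τ, ⟨hτ, hτρ⟩, hleast⟩ := hcl.exists_isLeast hne
    have hτρ' : dist (γ τ) e = ρ := hτρ
    have hin : ∀ s ∈ Icc 0 τ, γ s ∈ Metric.ball e r := by
      intro s hs
      refine lt_of_le_of_lt ?_ hρr
      by_contra! hgt
      obtain ⟨s', hs', hse⟩ := intermediate_value_Icc hs.1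
        (hcont.mono (Icc_subset_Icc_right (hs.2.trans hτ.2))) ⟨le_of_lt h0.1, le_of_lt hgt⟩
      have h1 := hleast ⟨⟨hs'.1, hs'.2.trans (hs.2.trans hτ.2)⟩, hse⟩
      have h2 : s = τ := le_antisymm hs.2 (h1.trans hs'.2)
      rw [h2, hτρ'] at hgt
      exact lt_irrefl _ hgt
    have hanti := S.antitoneOn_inner_sub hdec (convex_Icc 0 τ) Icc_subset_Ici_self hγ hconst hin
      (fun _ _ => Metric.mem_ball_self hr) (left_mem_Icc.2 hτ.1) (right_mem_Icc.2 hτ.1) hτ.1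
    have h1 := hcoer (γ τ - e)
    rw [← dist_eq_norm, hτρ'] at h1
    exact absurd (h1.trans hanti) (not_le.2 h0.2)
  obtain ⟨e', he', hlim⟩ := S.exists_tendsto hiso hγ
  have hmem : e' ∈ Metric.closedBall e ρ := Metric.isClosed_closedBall.mem_of_tendsto hlim
    ((eventually_ge_atTop 0).mono fun t ht => hstay t ht)
  have : e' = e := by
    by_contra hne
    exact hball ⟨lt_of_le_of_lt hmem hρr', hne⟩ he'
  rwa [this] at hlim

theorem isOpen_attractedSet (hiso : ∀ z, gradient f z = 0 → ∀ᶠ y in 𝓝[≠] z, gradient f y ≠ 0)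
    (he : gradient f e = 0)
    (hpos : ∀ v, v ≠ 0 → 0 < inner ℝ (fderiv ℝ (gradient f) e v) v) :
    IsOpen (attractedSet f A e) := by
  obtain ⟨U, hU, hUlim⟩ := S.exists_nhds_tendsto hiso he hpos
  rw [isOpen_iff_mem_nhds]
  rintro _ ⟨γ, hγ, rfl, hlim⟩
  obtain ⟨T, hTU, hT0⟩ :=
    ((hlim.eventually (eventually_mem_nhds_iff.2 hU)).and (eventually_ge_atTop 0)).exists
  obtain ⟨ε, hε, hball⟩ := Metric.mem_nhds_iff.1 hTU
  -- The slack `1` puts all nearby initial points into the same sublevel set.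
  obtain ⟨K, hK⟩ := S.exists_dist_le (f (γ 0) + 1)
  filter_upwards [Metric.ball_mem_nhds (γ 0) (div_pos hε (Real.exp_pos (K * T))),
    S.continuous_potential.continuousAt.eventually_lt continuousAt_const (lt_add_one (f (γ 0)))]
    with y hy hfy
  obtain ⟨ψ, hψ, rfl⟩ := S.exists_trajectory y
  have h1 := (hK _ _ hψ hγ hfy.le (lt_add_one _).le T hT0).1
  have h2 : ψ T ∈ U := hball (h1.trans_lt ((lt_div_iff₀ (Real.exp_pos _)).1 hy))
  have h3 := hUlim _ (hψ.shift hT0) (by simpa using h2)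
  exact ⟨ψ, hψ, rfl, by
    simpa [Function.comp_def] using
      h3.comp (tendsto_atTop_add_const_right atTop (-T) tendsto_id)⟩

end IsProperGradientSystem

end CriticalPoints

/-! ### Matrices as operators: positivity and smoothness -/

section MatrixOperators

variable {D : ℕ}

theorem Matrix.PosDef.inner_toEuclideanCLM_pos {A : Matrix (Fin D) (Fin D) ℝ} (hA : A.PosDef)
    {v : EuclideanSpace ℝ (Fin D)} (hv : v ≠ 0) :
    0 < inner ℝ (Matrix.toEuclideanCLM (𝕜 := ℝ) A v) v := by
  rw [real_inner_comm, Matrix.inner_toEuclideanCLM]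
  simpa using hA.dotProduct_mulVec_pos (x := v.ofLp) (by simpa using hv)

theorem contDiff_toEuclideanCLM {E : Type*} [NormedAddCommGroup E] [NormedSpace ℝ E]
    {n : WithTop ℕ∞} {R : E → Matrix (Fin D) (Fin D) ℝ}
    (hR : ∀ i j, ContDiff ℝ n (fun x => R x i j)) :
    ContDiff ℝ n (fun x => Matrix.toEuclideanCLM (𝕜 := ℝ) (R x)) := by
  have h : ∀ x, Matrix.toEuclideanCLM (𝕜 := ℝ) (R x) =
      ∑ i, ∑ j, R x i j • Matrix.toEuclideanCLM (𝕜 := ℝ) (Matrix.single i j (1 : ℝ)) := by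
    intro x
    conv_lhs => rw [Matrix.matrix_eq_sum_single (R x)]
    simp only [map_sum, ← map_smul, Matrix.smul_single, smul_eq_mul, mul_one]
  simp only [h]
  exact ContDiff.sum fun i _ => ContDiff.sum fun j _ => (hR i j).smul contDiff_const

theorem contDiff_toEuclideanCLM_inv {E : Type*} [NormedAddCommGroup E] [NormedSpace ℝ E]
    {n : WithTop ℕ∞} {R : E → Matrix (Fin D) (Fin D) ℝ}
    (hR : ∀ i j, ContDiff ℝ n (fun x => R x i j)) (hpos : ∀ x, (R x).PosDef) :
    ContDiff ℝ n (fun x => Matrix.toEuclideanCLM (𝕜 := ℝ) (R x)⁻¹) := by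
  let u : E → (EuclideanSpace ℝ (Fin D) →L[ℝ] EuclideanSpace ℝ (Fin D))ˣ := fun x =>
    Units.map (Matrix.toEuclideanCLM (n := Fin D) (𝕜 := ℝ) : _ →* _) (hpos x).isUnit.unit
  have hu : ∀ x, (u x : EuclideanSpace ℝ (Fin D) →L[ℝ] EuclideanSpace ℝ (Fin D)) =
      Matrix.toEuclideanCLM (𝕜 := ℝ) (R x) := fun x => rfl
  have hinv : ∀ x, Matrix.toEuclideanCLM (𝕜 := ℝ) (R x)⁻¹ =
      Ring.inverse (Matrix.toEuclideanCLM (𝕜 := ℝ) (R x)) := by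
    intro x
    have h := Matrix.coe_units_inv (hpos x).isUnit.unit
    rw [IsUnit.unit_spec] at h
    rw [← hu, Ring.inverse_unit, ← h]
    rfl
  simp only [hinv]
  refine contDiff_iff_contDiffAt.2 fun x => ?_
  refine ContDiffAt.comp (g := Ring.inverse) x ?_ (contDiff_toEuclideanCLM hR).contDiffAt
  rw [← hu]
  exact contDiffAt_ringInverse ℝ (u x)

end MatrixOperators

/-! ### A single Gaussian near infinity -/

section Gaussians

variable {E : Type*} [NormedAddCommGroup E] [InnerProductSpace ℝ E]

theorem contDiff_exp_neg_inner (T : E →L[ℝ] E) (μ : E) {n : WithTop ℕ∞} :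
    ContDiff ℝ n (fun x => Real.exp (-(1 / 2) * inner ℝ (x - μ) (T (x - μ)))) := by
  have h : ContDiff ℝ n (fun x : E => x - μ) := contDiff_id.sub contDiff_const
  exact (contDiff_const.mul (h.inner ℝ (T.contDiff.comp h))).exp

variable [FiniteDimensional ℝ E]

theorem tendsto_exp_neg_inner_cocompact {T : E →L[ℝ] E}
    (hT : ∀ v, v ≠ 0 → 0 < inner ℝ (T v) v) (μ : E) :
    Tendsto (fun x => Real.exp (-(1 / 2) * inner ℝ (x - μ) (T (x - μ)))) (cocompact E) (𝓝 0) := by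
  obtain ⟨c, hc, hcoer⟩ := exists_mul_sq_norm_le_inner T hT
  refine Real.tendsto_exp_atBot.comp ?_
  have h1 : Tendsto (fun x => c * dist x μ ^ 2) (cocompact E) atTop :=
    ((tendsto_pow_atTop two_ne_zero).comp (tendsto_dist_right_cocompact_atTop μ)).const_mul_atTop hc
  have h2 : Tendsto (fun x => inner ℝ (x - μ) (T (x - μ))) (cocompact E) atTop := by
    refine tendsto_atTop_mono (fun x => ?_) h1
    rw [dist_eq_norm, real_inner_comm]
    exact hcoer _
  exact h2.const_mul_atTop_of_neg (by norm_num)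

/-- Along the direction `x` the quadratic term outweighs the terms linear in `μ`. This direction
does not depend on the component, so the signs survive summation over a mixture. -/
theorem eventually_fderiv_exp_neg_inner_self_neg {T : E →L[ℝ] E}
    (hT : ∀ v, v ≠ 0 → 0 < inner ℝ (T v) v) (μ : E) :
    ∀ᶠ x in cocompact E,
      fderiv ℝ (fun x => Real.exp (-(1 / 2) * inner ℝ (x - μ) (T (x - μ)))) x x < 0 := by
  obtain ⟨c, hc, hcoer⟩ := exists_mul_sq_norm_le_inner T hT
  filter_upwards [tendsto_norm_cocompact_atTop.eventually_gt_atTop (‖T‖ * ‖μ‖ / c)] with x hx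
  have hd : HasFDerivAt (fun x : E => x - μ) (ContinuousLinearMap.id ℝ E) x :=
    (hasFDerivAt_id x).sub_const μ
  have hdT : HasFDerivAt (fun x : E => T (x - μ)) (T ∘L ContinuousLinearMap.id ℝ E) x :=
    T.hasFDerivAt.comp x hd
  have h1 := ((hd.inner ℝ hdT).const_mul (-(1 / 2) : ℝ)).exp
  have h2 : fderiv ℝ (fun x => Real.exp (-(1 / 2) * inner ℝ (x - μ) (T (x - μ)))) x x =
      Real.exp (-(1 / 2) * inner ℝ (x - μ) (T (x - μ))) *
        (-(1 / 2) * (inner ℝ (x - μ) (T x) + inner ℝ x (T (x - μ)))) := by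
    rw [HasFDerivAt.fderiv h1]
    simp [fderivInnerCLM_apply]
  rw [h2]
  refine mul_neg_of_pos_of_neg (Real.exp_pos _) ?_
  have h3 := hcoer x
  have h4 : inner ℝ μ (T x) ≤ ‖T‖ * ‖μ‖ * ‖x‖ := by
    calc inner ℝ μ (T x) ≤ ‖μ‖ * ‖T x‖ := real_inner_le_norm _ _
      _ ≤ ‖μ‖ * (‖T‖ * ‖x‖) := by gcongr; exact T.le_opNorm x
      _ = _ := by ring
  have h5 : inner ℝ x (T μ) ≤ ‖T‖ * ‖μ‖ * ‖x‖ := by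
    calc inner ℝ x (T μ) ≤ ‖x‖ * ‖T μ‖ := real_inner_le_norm _ _
      _ ≤ ‖x‖ * (‖T‖ * ‖μ‖) := by gcongr; exact T.le_opNorm μ
      _ = _ := by ring
  have hx' : ‖T‖ * ‖μ‖ < ‖x‖ * c := (div_lt_iff₀ hc).1 hx
  have hx0 : 0 < ‖x‖ := lt_of_le_of_lt (by positivity) hx
  have h6 : ‖T‖ * ‖μ‖ * ‖x‖ < c * ‖x‖ ^ 2 := by nlinarith
  rw [map_sub, inner_sub_left, inner_sub_right, real_inner_comm (T x) x]
  linarith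

end Gaussians

/-! ### The mixture potential: smoothness, properness, critical points -/

namespace GaussianMixture

variable {D K : ℕ} (M : GaussianMixture D K)

theorem inner_inv_cov_pos (k : Fin K) (v : EuclideanSpace ℝ (Fin D)) (hv : v ≠ 0) :
    0 < inner ℝ (Matrix.toEuclideanCLM (𝕜 := ℝ) (M.cov k)⁻¹ v) v :=
  (M.cov_posDef k).inv.inner_toEuclideanCLM_pos hv

theorem exists_density_eq : ∃ a : Fin K → ℝ, (∀ k, 0 < a k) ∧ M.density = fun x => ∑ k, a k *
    Real.exp (-(1 / 2) * inner ℝ (x - M.mean k)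
      (Matrix.toEuclideanCLM (𝕜 := ℝ) (M.cov k)⁻¹ (x - M.mean k))) := by
  refine ⟨fun k => M.weight k *
    ((2 * Real.pi) ^ (-(D : ℝ) / 2) * (M.cov k).det ^ (-(1 : ℝ) / 2)), fun k => ?_, ?_⟩
  · have := M.weight_pos k
    have := (M.cov_posDef k).det_pos
    positivity
  · funext x
    simp only [density, gaussianDensity, mul_assoc]

include M in
theorem nonempty_components : Nonempty (Fin K) := by
  by_contra h
  rw [not_nonempty_iff] at h
  simpa using M.weight_sum

theorem density_pos (x : EuclideanSpace ℝ (Fin D)) : 0 < M.density x := by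
  obtain ⟨a, ha, h⟩ := M.exists_density_eq
  have := M.nonempty_components
  rw [h]
  exact Finset.sum_pos (fun k _ => mul_pos (ha k) (Real.exp_pos _)) Finset.univ_nonempty

theorem contDiff_density {n : WithTop ℕ∞} : ContDiff ℝ n M.density := by
  obtain ⟨a, -, h⟩ := M.exists_density_eq
  rw [h]
  exact ContDiff.sum fun k _ => contDiff_const.mul (contDiff_exp_neg_inner _ _)

theorem contDiff_potential {n : WithTop ℕ∞} : ContDiff ℝ n M.potential :=
  (M.contDiff_density.log fun x => (M.density_pos x).ne').neg

theorem tendsto_density_cocompact : Tendsto M.density (cocompact _) (𝓝 0) := by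
  obtain ⟨a, -, h⟩ := M.exists_density_eq
  rw [h]
  simpa using tendsto_finsetSum Finset.univ fun k _ =>
    (tendsto_exp_neg_inner_cocompact (M.inner_inv_cov_pos k) (M.mean k)).const_mul (a k)

theorem isCompact_sublevel_potential (c : ℝ) : IsCompact {x | M.potential x ≤ c} := by
  have hcl : IsClosed {x | M.potential x ≤ c} :=
    isClosed_le (M.contDiff_potential (n := 0)).continuous continuous_const
  obtain ⟨s, hs, hsub⟩ := mem_cocompact.1
    (M.tendsto_density_cocompact.eventually (gt_mem_nhds (Real.exp_pos (-c))))
  refine hs.of_isClosed_subset hcl fun x hx => ?_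
  by_contra hxs
  have h1 : M.density x < Real.exp (-c) := hsub hxs
  have h2 : -Real.log (M.density x) ≤ c := hx
  have h3 := (Real.log_lt_iff_lt_exp (M.density_pos x)).2 h1
  linarith

theorem eventually_gradient_potential_ne_zero :
    ∀ᶠ x in cocompact _, gradient M.potential x ≠ 0 := by
  obtain ⟨a, ha, h⟩ := M.exists_density_eq
  have := M.nonempty_components
  filter_upwards [eventually_all.2 fun k =>
    eventually_fderiv_exp_neg_inner_self_neg (M.inner_inv_cov_pos k) (M.mean k)] with x hx hgrad
  have hd : HasFDerivAt M.density (fderiv ℝ M.density x) x :=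
    ((M.contDiff_density (n := 1)).differentiable one_ne_zero x).hasFDerivAt
  have h1 : fderiv ℝ M.potential x = -((M.density x)⁻¹ • fderiv ℝ M.density x) :=
    (hd.log (M.density_pos x).ne').neg.fderiv
  have h2 : fderiv ℝ M.potential x x = 0 := by
    rw [← inner_gradient_left, hgrad, inner_zero_left]
  have h3 : fderiv ℝ M.density x x = ∑ k, a k * fderiv ℝ (fun x => Real.exp (-(1 / 2) *
      inner ℝ (x - M.mean k) (Matrix.toEuclideanCLM (𝕜 := ℝ) (M.cov k)⁻¹ (x - M.mean k)))) x x := by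
    have hk : ∀ k, HasFDerivAt (fun x => Real.exp (-(1 / 2) * inner ℝ (x - M.mean k)
        (Matrix.toEuclideanCLM (𝕜 := ℝ) (M.cov k)⁻¹ (x - M.mean k)))) _ x := fun k =>
      ((contDiff_exp_neg_inner _ _ (n := 1)).differentiable one_ne_zero x).hasFDerivAt
    rw [h, (HasFDerivAt.fun_sum fun k _ => (hk k).const_mul (a k)).fderiv]
    simp
  have h4 : fderiv ℝ M.density x x < 0 := by
    rw [h3]
    exact Finset.sum_neg (fun k _ => mul_neg_of_pos_of_neg (ha k) (hx k)) Finset.univ_nonempty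
  rw [h1] at h2
  simp [(M.density_pos x).ne', h4.ne] at h2

end GaussianMixture

/-! ### Eigenvalue conditions as properties of the Hessian form -/

section Equilibria

variable {D : ℕ} {f : EuclideanSpace ℝ (Fin D) → ℝ} {e : EuclideanSpace ℝ (Fin D)}

theorem IsHyperbolicEquilibrium.injective_hessian (h : IsHyperbolicEquilibrium f e) :
    Function.Injective (fderiv ℝ (gradient f) e) := by
  refine (injective_iff_map_eq_zero _).2 fun v hv => ?_
  by_contra hne
  exact h.2 (Module.End.hasEigenvalue_of_hasEigenvector
    ⟨Module.End.mem_eigenspace_iff.2 (by simpa [hessianOp] using hv), hne⟩)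

theorem IsStableEquilibrium.inner_hessian_pos (hf : ContDiff ℝ 2 f) (h : IsStableEquilibrium f e)
    (v : EuclideanSpace ℝ (Fin D)) (hv : v ≠ 0) :
    0 < inner ℝ (fderiv ℝ (gradient f) e v) v := by
  have hsymm : (hessianOp f e).IsSymmetric := fun v w => inner_fderiv_gradient_symm hf e v w
  set b := hsymm.eigenvectorBasis rfl
  have hb : ∀ i, inner ℝ (hessianOp f e v) (b i) = hsymm.eigenvalues rfl i * inner ℝ v (b i) := by
    intro i
    rw [hsymm, hsymm.apply_eigenvectorBasis rfl i]
    exact real_inner_smul_right _ _ _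
  have hsum : inner ℝ (hessianOp f e v) v = ∑ i, hsymm.eigenvalues rfl i * inner ℝ v (b i) ^ 2 := by
    rw [← b.sum_inner_mul_inner]
    refine Finset.sum_congr rfl fun i _ => ?_
    rw [hb, real_inner_comm v (b i)]
    ring
  have hpos : ∀ i, 0 < hsymm.eigenvalues rfl i := fun i =>
    h.2 _ (hsymm.hasEigenvalue_eigenvalues rfl i)
  obtain ⟨i, hi⟩ : ∃ i, inner ℝ v (b i) ≠ 0 := by
    by_contra! hall
    refine hv (inner_self_eq_zero.1 (?_ : inner ℝ v v = (0 : ℝ)))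
    rw [← b.sum_inner_mul_inner]
    exact Finset.sum_eq_zero fun i _ => by rw [hall, zero_mul]
  change 0 < inner ℝ (hessianOp f e v) v
  rw [hsum]
  exact Finset.sum_pos' (fun j _ => mul_nonneg (hpos j).le (sq_nonneg _))
    ⟨i, Finset.mem_univ i, mul_pos (hpos i) (by positivity)⟩

theorem IsHyperbolicEquilibrium.exists_inner_hessian_neg (h : IsHyperbolicEquilibrium f e)
    (hns : ¬ IsStableEquilibrium f e) : ∃ u, inner ℝ (fderiv ℝ (gradient f) e u) u < 0 := by
  obtain ⟨c, hc, hc0⟩ : ∃ c : ℝ, (hessianOp f e).HasEigenvalue c ∧ c ≤ 0 := by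
    by_contra! hcon
    exact hns ⟨h, hcon⟩
  have hc' : c < 0 := lt_of_le_of_ne hc0 fun h0 => h.2 (h0 ▸ hc)
  obtain ⟨u, hu⟩ := hc.exists_hasEigenvector
  have h1 : fderiv ℝ (gradient f) e u = c • u := hu.apply_eq_smul
  refine ⟨u, ?_⟩
  rw [h1, real_inner_smul_left]
  exact mul_neg_of_neg_of_pos hc' (real_inner_self_pos.2 hu.2)

end Equilibria

/-! ### Finiteness of equilibria and the basin decomposition -/

theorem disjoint_attractedSet {E : Type*} [NormedAddCommGroup E] [InnerProductSpace ℝ E]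
    [FiniteDimensional ℝ E] {f : E → ℝ} {A : E → E →L[ℝ] E} (S : IsProperGradientSystem f A)
    {e e' : E} (hne : e ≠ e') : Disjoint (attractedSet f A e) (attractedSet f A e') := by
  rw [Set.disjoint_left]
  rintro x ⟨γ, hγ, h0, hlim⟩ ⟨γ', hγ', h0', hlim'⟩
  refine hne (tendsto_nhds_unique hlim (hlim'.congr' ?_))
  filter_upwards [eventually_ge_atTop 0] with t ht
  exact S.trajectory_unique hγ' hγ (h0'.trans h0.symm) ht

/-- Infinitely many equilibria in a compact set would accumulate at an equilibrium, which is
isolated by nondegeneracy. -/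
theorem GaussianMixture.finite_equilibria {D K : ℕ} (M : GaussianMixture D K)
    (hM : IsMorse M.potential) : {e | IsEquilibrium M.potential e}.Finite := by
  by_contra hinf
  obtain ⟨s, hs, hsub⟩ := mem_cocompact.1 M.eventually_gradient_potential_ne_zero
  have hss : {e | IsEquilibrium M.potential e} ⊆ s := fun e he => by
    by_contra hes
    exact hsub hes he
  obtain ⟨z, -, hz⟩ := Set.Infinite.exists_accPt_of_subset_isCompact hinf hs hss
  have hfreq := accPt_iff_frequently_nhdsNE.1 hz
  have hz0 : gradient M.potential z = 0 := by
    have hcl : IsClosed {e | IsEquilibrium M.potential e} :=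
      isClosed_eq M.contDiff_potential.gradient.continuous continuous_const
    exact hcl.mem_of_frequently_of_tendsto (hfreq.filter_mono nhdsWithin_le_nhds) tendsto_id
  exact hfreq ((eventually_gradient_ne_zero M.contDiff_potential
    (hM z hz0).injective_hessian).mono fun y hy h => hy h)

theorem theorem3 {D K : ℕ} (M : GaussianMixture D K) (hM : IsMorse M.potential)
    (R : EuclideanSpace ℝ (Fin D) → Matrix (Fin D) (Fin D) ℝ)
    (hRpos : ∀ x, (R x).PosDef)
    (hRdiff : ∀ i j, ContDiff ℝ 1 (fun x => R x i j))
    (hRcond : ∃ C : ℝ, ∀ x, conditionNumber (R x) ≤ C) :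
    -- from every initial point there is exactly one trajectory
    (∀ x, ∃ γ, IsTrajectory M.potential R γ ∧ γ 0 = x) ∧
    (∀ γ γ', IsTrajectory M.potential R γ → IsTrajectory M.potential R γ' → γ 0 = γ' 0 →
      EqOn γ γ' (Ici 0)) ∧
    -- every trajectory is bounded and converges to an equilibrium vector
    (∀ γ, IsTrajectory M.potential R γ →
      Bornology.IsBounded (γ '' Ici 0) ∧
        ∃ e, IsEquilibrium M.potential e ∧ Tendsto γ atTop (𝓝 e)) ∧
    -- the stable equilibrium vectors are finitely many, their basin cells cover the space
    {e | IsStableEquilibrium M.potential e}.Finite ∧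
    (⋃ e ∈ {e | IsStableEquilibrium M.potential e}, basinCell M.potential R e) = univ ∧
    -- and any two of these basin cells meet in a Lebesgue null set
    (∀ e e', IsStableEquilibrium M.potential e → IsStableEquilibrium M.potential e' → e ≠ e' →
      volume (basinCell M.potential R e ∩ basinCell M.potential R e') = 0) := by
  let A : EuclideanSpace ℝ (Fin D) → EuclideanSpace ℝ (Fin D) →L[ℝ] EuclideanSpace ℝ (Fin D) :=
    fun x => Matrix.toEuclideanCLM (𝕜 := ℝ) (R x)⁻¹
  have S : IsProperGradientSystem M.potential A :=
    ⟨M.contDiff_potential, contDiff_toEuclideanCLM_inv hRdiff hRpos,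
      fun x v hv => (hRpos x).inv.inner_toEuclideanCLM_pos hv, M.isCompact_sublevel_potential⟩
  have hiso : ∀ z, gradient M.potential z = 0 → ∀ᶠ y in 𝓝[≠] z, gradient M.potential y ≠ 0 :=
    fun z hz => eventually_gradient_ne_zero M.contDiff_potential (hM z hz).injective_hessian
  have hfin := M.finite_equilibria hM
  have hfinS : {e | IsStableEquilibrium M.potential e}.Finite := hfin.subset fun e he => he.1.1
  have hcell : ∀ e, basinCell M.potential R e = closure (attractedSet M.potential A e) :=
    fun e => rfl
  have hopen : ∀ e, IsStableEquilibrium M.potential e → IsOpen (attractedSet M.potential A e) :=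
    fun e he => S.isOpen_attractedSet hiso he.1.1 (he.inner_hessian_pos M.contDiff_potential)
  set N : Set (EuclideanSpace ℝ (Fin D)) :=
    ⋃ e ∈ {e | IsEquilibrium M.potential e ∧ ¬ IsStableEquilibrium M.potential e},
      attractedSet M.potential A e with hN
  have hnull : volume N = 0 := by
    refine (measure_biUnion_null_iff (hfin.subset fun e he => he.1).countable).2 fun e he => ?_
    obtain ⟨u, hu⟩ := (hM e he.1).exists_inner_hessian_neg he.2
    exact S.volume_attractedSet_eq_zero he.1 (hM e he.1).injective_hessian hu
  have hcover : ∀ x, x ∉ N →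
      ∃ e, IsStableEquilibrium M.potential e ∧ x ∈ attractedSet M.potential A e := by
    intro x hx
    obtain ⟨γ, hγ, h0⟩ := S.exists_trajectory x
    obtain ⟨e, he, hlim⟩ := S.exists_tendsto hiso hγ
    refine ⟨e, ?_, γ, hγ, h0, hlim⟩
    by_contra hns
    exact hx (mem_biUnion (show _ ∧ _ from ⟨he, hns⟩) ⟨γ, hγ, h0, hlim⟩)
  refine ⟨S.exists_trajectory, fun γ γ' h h' => S.trajectory_unique h h', fun γ h =>
    ⟨S.isBounded_trajectory h, S.exists_tendsto hiso h⟩, hfinS, ?_, fun e e' he he' hne => ?_⟩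
  · simp only [hcell]
    -- Finiteness lets closure commute with the union, so density of the union suffices; it contains
    -- the complement of the null set `N`.
    rw [← hfinS.closure_biUnion, ← dense_iff_closure_eq]
    have hdense : Dense Nᶜ := by
      rw [← interior_eq_empty_iff_dense_compl]
      exact Measure.interior_eq_empty_of_null hnull
    refine hdense.mono fun x hx => ?_
    obtain ⟨e, he, hxe⟩ := hcover x hx
    exact mem_biUnion he hxe
  · refine measure_mono_null (fun x hx => ?_) hnull
    by_contra hxN
    obtain ⟨e'', he'', hx''⟩ := hcover x hxN
    -- The attracted set of `e''` is an open neighborhood of `x`, so it meets any attracted set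
    -- whose closure contains `x`; disjointness then identifies the limits.
    have key : ∀ a, x ∈ basinCell M.potential R a → e'' = a := by
      intro a ha
      by_contra hne'
      obtain ⟨y, hy, hya⟩ := mem_closure_iff.1 ha _ (hopen e'' he'') hx''
      exact Set.disjoint_left.1 (disjoint_attractedSet S hne') hy hya
    exact hne ((key e hx.1).symm.trans (key e' hx.2))
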